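/- All graphs are finite and simple. For a graph $G$ with non-empty vertex set $V$ let $\lambda_{\max}(G)$ be the largest eigenvalue of its adjacency matrix, and let $$M(G):=\max_{\varnothing\ne X,Y\subseteq V}\frac{e(X,Y)}{\sqrt{|X||Y|}},$$ where $e(X,Y)$ is the number of pairs $(x,y)\in X\times Y$ with $x$ adjacent to $y$. For integers $s\ge 2$ and $t\ge 1$ let $$A_s^{(t)}:=\begin{pmatrix}J_s-I_s & I_s\\ I_s & 0\end{pmatrix}^{\otimes t}$$ be the $t$-th Kronecker power, where $I_s$ is the identity matrix and $J_s$ the all-ones matrix of order $s$. Put $t:=s^8$ and $n:=(2s)^t$. Then $A_s^{(t)}$ is the adjacency matrix of a graph $G_s$ of order $n$, and there is an absolute constant $C>0$ such that for every $s\ge 2$ $$M(G_s)\le C\left(\frac{\log\log n}{\log n}\right)^{1/8}\lambda_{\max}(G_s).$$ The orders $n=(2s)^{s^8}$ are arbitrarily large, and $M(G_s)=o(\lambda_{\max}(G_s))$ as $s\to\infty$. Consequently, if $f$ is a real function on the non-negative integers with $\lambda_{\max}(G)\le f(|V|)\,M(G)$ for every graph $G$ with non-empty vertex set $V$, then $f(n)$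 is not $o\big((\log n/\log\log n)^{1/8}\big)$ as $n\to\infty$; in particular, for every real $K$ there is a graph $G$ with $\lambda_{\max}(G)>K\,M(G)$. -/

import Mathlib

noncomputable section

/-- The adjacency matrix of a graph, as a real matrix (Mathlib's `SimpleGraph.adjMatrix`, with
classical decidability of adjacency). -/
def realAdjMatrix {V : Type*} (G : SimpleGraph V) : Matrix V V ℝ :=
  open Classical in G.adjMatrix ℝ

/-- The number `e(X, Y)` of pairs `(x, y)` with `x ∈ X`, `y ∈ Y` and `x` adjacent to `y`. -/
def edgeCount {V : Type*} (G : SimpleGraph V) (X Y : Finset V) : ℕ :=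
  open Classical in (G.interedges X Y).card

/-- The maximum bi-average degree: the maximum of `e(X, Y) / √(|X| |Y|)` over all pairs of
non-empty sets of vertices. -/
def maxBiAverageDegree {V : Type*} (G : SimpleGraph V) : ℝ :=
  sSup {r : ℝ | ∃ X Y : Finset V, X.Nonempty ∧ Y.Nonempty ∧
    r = (edgeCount G X Y : ℝ) / √((X.card : ℝ) * (Y.card : ℝ))}

/-- The largest eigenvalue of a finite graph, that is, of its adjacency matrix. -/
def largestEigenvalue {V : Type*} [Fintype V] (G : SimpleGraph V) : ℝ :=
  sSup {μ : ℝ | Module.End.HasEigenvalue (realAdjMatrix G).mulVecLin μ}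

/-- The maximum in `maxBiAverageDegree` is attained. -/
theorem isGreatest_maxBiAverageDegree {V : Type*} [Fintype V] [Nonempty V] (G : SimpleGraph V) :
    IsGreatest {r : ℝ | ∃ X Y : Finset V, X.Nonempty ∧ Y.Nonempty ∧
      r = (edgeCount G X Y : ℝ) / √((X.card : ℝ) * (Y.card : ℝ))} (maxBiAverageDegree G) := by
  have hfin : {r : ℝ | ∃ X Y : Finset V, X.Nonempty ∧ Y.Nonempty ∧
      r = (edgeCount G X Y : ℝ) / √((X.card : ℝ) * (Y.card : ℝ))}.Finite := by
    refine (Set.finite_range (fun p : Finset V × Finset V =>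
      (edgeCount G p.1 p.2 : ℝ) / √((p.1.card : ℝ) * (p.2.card : ℝ)))).subset ?_
    rintro r ⟨X, Y, -, -, rfl⟩
    exact ⟨(X, Y), rfl⟩
  have hne : {r : ℝ | ∃ X Y : Finset V, X.Nonempty ∧ Y.Nonempty ∧
      r = (edgeCount G X Y : ℝ) / √((X.card : ℝ) * (Y.card : ℝ))}.Nonempty :=
    ⟨_, Finset.univ, Finset.univ, Finset.univ_nonempty, Finset.univ_nonempty, rfl⟩
  exact ⟨hne.csSup_mem hfin, fun r hr => le_csSup hfin.bddAbove hr⟩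

/-- The largest eigenvalue is an eigenvalue, and no eigenvalue exceeds it. -/
theorem isGreatest_largestEigenvalue {V : Type*} [Fintype V] [Nonempty V] (G : SimpleGraph V) :
    IsGreatest {μ : ℝ | Module.End.HasEigenvalue (realAdjMatrix G).mulVecLin μ}
      (largestEigenvalue G) := by
  classical
  have hfin : {μ : ℝ | Module.End.HasEigenvalue (realAdjMatrix G).mulVecLin μ}.Finite :=
    Module.End.finite_hasEigenvalue _
  have hH : (realAdjMatrix G).IsHermitian := by
    ext i j
    simp [realAdjMatrix, Matrix.conjTranspose_apply, SimpleGraph.adjMatrix_apply, G.adj_comm]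
  have hne : {μ : ℝ | Module.End.HasEigenvalue (realAdjMatrix G).mulVecLin μ}.Nonempty := by
    obtain ⟨i⟩ := ‹Nonempty V›
    refine ⟨hH.eigenvalues i, Module.End.hasEigenvalue_of_hasEigenvector
      (x := (hH.eigenvectorBasis i).ofLp) ⟨?_, ?_⟩⟩
    · rw [Module.End.mem_eigenspace_iff]
      simpa using hH.mulVec_eigenvectorBasis i
    · intro h
      exact hH.eigenvectorBasis.orthonormal.ne_zero i (by ext j; simpa using congrFun h j)
  exact ⟨hne.csSup_mem hfin, fun r hr => le_csSup hfin.bddAbove hr⟩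

/-- The `t`-th Kronecker (tensor) power of a square matrix `A`, with rows and columns indexed by
`t`-tuples of indices of `A`. -/
def kroneckerPower {ι : Type*} (A : Matrix ι ι ℝ) (t : ℕ) : Matrix (Fin t → ι) (Fin t → ι) ℝ :=
  Matrix.of fun x y => ∏ i, A (x i) (y i)

/-- Up to the identification of `(t + 1)`-tuples with pairs (element, `t`-tuple), the Kronecker
power satisfies `A^{⊗(t+1)} = A ⊗ A^{⊗t}`. -/
theorem kroneckerPower_succ {ι : Type*} (A : Matrix ι ι ℝ) (t : ℕ) :
    kroneckerPower A (t + 1) =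
      Matrix.reindex (Fin.consEquiv fun _ : Fin (t + 1) => ι)
        (Fin.consEquiv fun _ : Fin (t + 1) => ι)
        (Matrix.kronecker A (kroneckerPower A t)) := by
  ext x y
  simp [kroneckerPower, Matrix.kroneckerMap_apply, Fin.prod_univ_succ, Fin.consEquiv, Fin.tail]

/-- The block matrix `[[J - I, I], [I, 0]]` of order `2 s`, with `J` the all-ones matrix. -/
def blockMatrix (s : ℕ) : Matrix (Fin s ⊕ Fin s) (Fin s ⊕ Fin s) ℝ :=
  Matrix.fromBlocks ((Matrix.of fun _ _ => 1) - 1) 1 1 0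

/-- The graph whose vertices are the indices of the `t`-th Kronecker power of `blockMatrix s`,
two distinct vertices being adjacent when the corresponding entry of that matrix is `1`. -/
def tensorGraph (s t : ℕ) : SimpleGraph (Fin t → Fin s ⊕ Fin s) :=
  SimpleGraph.fromRel fun x y => kroneckerPower (blockMatrix s) t x y = 1

end

/-! The bilinear form of the Kronecker power is expanded in the tensor power of an orthonormal
eigenbasis of `blockMatrix s`. Let `l` be the positive root of `l ^ 2 = (s - 1) * l + 1`, so `s / 2
≤ l ≤ s`. It is the principal eigenvalue, and all others have modulus at most 2
(`blockMatrix_eigenvector`). Hence `l ^ t` is an eigenvalue of the power, and a product of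
eigenvalues with a factor of modulus at most 2 is at most `(2 / l) * l ^ t`. By Cauchy–Schwarz these
products contribute at most `(2 / l) * l ^ t * √(#X * #Y)`.

What remains is the principal eigenvector, which must be nearly orthogonal to every normalized
indicator. Its entries depend only on the level and shrink by a factor `l` per level, while its
squared mass is binomially distributed over the levels. With `t = s ^ 8` the binomial is so spread
out that no level has mass above `2 / s` (`binomialWeight_le`). A set can then gain only from a few
neighbouring levels, which gives `sq_sum_prod_blockVector_le`. Together these yield a ratio of at
most `16 / s` (`maxBiAverageDegree_tensorGraph_le`). Finally `log n = s ^ 8 * log (2 * s)`, so `1 /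
s` is at most `(log log n / log n) ^ (1 / 8)`. -/

section

open Finset

/-! ### Kronecker powers and their spectral decomposition -/

section KroneckerPower

variable {ι : Type*} [Fintype ι]

theorem kroneckerPower_mul (A B : Matrix ι ι ℝ) (t : ℕ) :
    kroneckerPower (A * B) t = kroneckerPower A t * kroneckerPower B t := by
  classical
  ext x y
  simp only [kroneckerPower, Matrix.of_apply, Matrix.mul_apply]
  rw [Finset.prod_univ_sum, Fintype.piFinset_univ]
  simp only [Finset.prod_mul_distrib]

theorem kroneckerPower_transpose {ι : Type*} (A : Matrix ι ι ℝ) (t : ℕ) :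
    kroneckerPower A.transpose t = (kroneckerPower A t).transpose := rfl

theorem kroneckerPower_diagonal {ι : Type*} [DecidableEq ι] (d : ι → ℝ) (t : ℕ) :
    kroneckerPower (Matrix.diagonal d) t = Matrix.diagonal fun J => ∏ i, d (J i) := by
  ext x y
  by_cases h : x = y
  · subst h; simp [kroneckerPower]
  · obtain ⟨i, hi⟩ := Function.ne_iff.1 h
    rw [Matrix.diagonal_apply_ne _ h, kroneckerPower, Matrix.of_apply]
    exact Finset.prod_eq_zero (Finset.mem_univ i) (Matrix.diagonal_apply_ne _ hi)

theorem kroneckerPower_one {ι : Type*} [DecidableEq ι] (t : ℕ) :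
    kroneckerPower (1 : Matrix ι ι ℝ) t = 1 := by
  rw [← Matrix.diagonal_one, kroneckerPower_diagonal]
  simp

theorem kroneckerPower_mulVec_prod (A : Matrix ι ι ℝ) (f : ι → ℝ) (t : ℕ) :
    (kroneckerPower A t).mulVec (fun x => ∏ i, f (x i)) = fun x => ∏ i, A.mulVec f (x i) := by
  classical
  ext x
  simp only [kroneckerPower, Matrix.of_apply, Matrix.mulVec, dotProduct]
  rw [Finset.prod_univ_sum, Fintype.piFinset_univ]
  simp only [Finset.prod_mul_distrib]

/-- The bilinear form of a Kronecker power in a tensor power of an orthonormal eigenbasis. -/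
theorem dotProduct_kroneckerPower_mulVec [DecidableEq ι] {A U : Matrix ι ι ℝ} {e : ι → ℝ}
    (hA : A = U * Matrix.diagonal e * U.transpose) (t : ℕ) (f g : (Fin t → ι) → ℝ) :
    dotProduct f ((kroneckerPower A t).mulVec g) =
      ∑ J : Fin t → ι, (∏ i, e (J i)) * (Matrix.vecMul f (kroneckerPower U t) J *
        Matrix.vecMul g (kroneckerPower U t) J) := by
  rw [hA, kroneckerPower_mul, kroneckerPower_mul, kroneckerPower_diagonal,
    kroneckerPower_transpose, ← Matrix.mulVec_mulVec, ← Matrix.mulVec_mulVec,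
    Matrix.dotProduct_mulVec, Matrix.mulVec_transpose]
  simp only [dotProduct, Matrix.mulVec_diagonal]
  exact Finset.sum_congr rfl fun J _ => by ring

/-- Parseval in the tensor basis: the case `A = 1` of the bilinear formula, where all eigenvalues
are 1. -/
theorem sum_vecMul_kroneckerPower_sq [DecidableEq ι] {U : Matrix ι ι ℝ}
    (hU : U * U.transpose = 1) (t : ℕ) (f : (Fin t → ι) → ℝ) :
    ∑ J, Matrix.vecMul f (kroneckerPower U t) J ^ 2 = dotProduct f f := by
  have h := dotProduct_kroneckerPower_mulVec (A := 1) (U := U) (e := fun _ => 1)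
    (by simpa using hU.symm) t f f
  rw [kroneckerPower_one, Matrix.one_mulVec] at h
  rw [h]
  exact Finset.sum_congr rfl fun J _ => by simp [sq]

theorem Matrix.IsHermitian.exists_eigenvector_matrix [DecidableEq ι] {A : Matrix ι ι ℝ}
    (hA : A.IsHermitian) : ∃ (U : Matrix ι ι ℝ) (e : ι → ℝ), U * U.transpose = 1 ∧
      U.transpose * U = 1 ∧ A = U * Matrix.diagonal e * U.transpose ∧
      ∀ j, A.mulVec (fun i => U i j) = e j • fun i => U i j := by
  have h1 : (hA.eigenvectorUnitary : Matrix ι ι ℝ) *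
      (hA.eigenvectorUnitary : Matrix ι ι ℝ).transpose = 1 := by
    simpa [Matrix.star_eq_conjTranspose] using
      (Matrix.mem_unitaryGroup_iff.1 hA.eigenvectorUnitary.2)
  refine ⟨hA.eigenvectorUnitary, hA.eigenvalues, h1, mul_eq_one_comm.1 h1, ?_, fun j => ?_⟩
  · have := hA.spectral_theorem
    simpa [Unitary.conjStarAlgAut_apply, Matrix.star_eq_conjTranspose, Function.comp_def] using this
  · exact hA.mulVec_eigenvectorBasis j

end KroneckerPower

/-! ### Spectrum of the block matrix -/

section BlockMatrix

variable {s : ℕ}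

theorem blockMatrix_isHermitian (s : ℕ) : (blockMatrix s).IsHermitian := by
  ext i j
  rcases i with i | i <;> rcases j with j | j <;>
    simp [blockMatrix, Matrix.one_apply, eq_comm]

theorem blockMatrix_mulVec_inl (f : Fin s ⊕ Fin s → ℝ) (i : Fin s) :
    (blockMatrix s).mulVec f (Sum.inl i) =
      (∑ j, f (Sum.inl j)) - f (Sum.inl i) + f (Sum.inr i) := by
  simp [blockMatrix, Matrix.mulVec, dotProduct, Matrix.one_apply, sub_mul, Finset.sum_sub_distrib]

theorem blockMatrix_mulVec_inr (f : Fin s ⊕ Fin s → ℝ) (i : Fin s) :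
    (blockMatrix s).mulVec f (Sum.inr i) = f (Sum.inl i) := by
  simp [blockMatrix, Matrix.mulVec, dotProduct, Matrix.one_apply]

/-- The principal eigenvector of `blockMatrix s`, up to scaling. -/
def blockVector (s : ℕ) (l b : ℝ) : Fin s ⊕ Fin s → ℝ := Sum.elim (fun _ => l * b) fun _ => b

theorem blockMatrix_mulVec_blockVector {l : ℝ} (hl : l ^ 2 = (s - 1) * l + 1) (b : ℝ) :
    (blockMatrix s).mulVec (blockVector s l b) = l • blockVector s l b := by
  ext (i | i)
  · rw [blockMatrix_mulVec_inl]
    simp only [blockVector, Sum.elim_inl, Sum.elim_inr, Finset.sum_const, Finset.card_univ,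
      Fintype.card_fin, nsmul_eq_mul, Pi.smul_apply, smul_eq_mul]
    linear_combination -b * hl
  · rw [blockMatrix_mulVec_inr]
    simp [blockVector]

/-- Every eigenvalue other than the principal one is small, and the eigenvectors of the principal
one are multiples of `blockVector`. -/
theorem blockMatrix_eigenvector {l : ℝ} (hs : 2 ≤ s) (hl0 : 0 < l)
    (hl : l ^ 2 = (s - 1) * l + 1) {μ : ℝ} {f : Fin s ⊕ Fin s → ℝ} (hf : f ≠ 0)
    (h : (blockMatrix s).mulVec f = μ • f) :
    |μ| ≤ l ∧ (|μ| ≤ 2 ∨ μ = l ∧ ∃ b, f = blockVector s l b) := by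
  have hs' : (2 : ℝ) ≤ s := by exact_mod_cast hs
  have hl1 : 1 + l ≤ l ^ 2 := by nlinarith
  have hl2 : 1 ≤ l := by nlinarith
  have h1 (i : Fin s) : (∑ j, f (Sum.inl j)) - f (Sum.inl i) + f (Sum.inr i) =
      μ * f (Sum.inl i) := by
    rw [← blockMatrix_mulVec_inl, h]; rfl
  have h2 (i : Fin s) : f (Sum.inl i) = μ * f (Sum.inr i) := by
    rw [← blockMatrix_mulVec_inr f i, h]; rfl
  -- Eliminating the first block leaves a scalar equation whose left side does not depend on `i`:
  -- unless `μ ^ 2 + μ = 1`, the vector is constant on each block.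
  have h3 (i : Fin s) : ∑ j, f (Sum.inl j) = (μ ^ 2 + μ - 1) * f (Sum.inr i) := by
    linear_combination h1 i + (μ + 1) * h2 i
  by_cases hμ : μ ^ 2 + μ - 1 = 0
  -- Here `|μ|` is at most the golden ratio, and `hl1` says that `l` is at least that. Equality
  -- occurs for `s = 2`.
  · have h4 : |μ| ≤ l := abs_le.2 ⟨by nlinarith, by nlinarith⟩
    exact ⟨h4, Or.inl (abs_le.2 ⟨by nlinarith, by nlinarith⟩)⟩
  · set b := (∑ j, f (Sum.inl j)) / (μ ^ 2 + μ - 1) with hb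
    have h4 (i : Fin s) : f (Sum.inr i) = b := by rw [hb, h3 i, mul_div_cancel_left₀ _ hμ]
    have h5 : f = blockVector s μ b := by
      ext (i | i)
      · simp [blockVector, h2, h4]
      · simp [blockVector, h4]
    have hb0 : b ≠ 0 := by
      rintro h0
      apply hf
      rw [h5, h0]
      ext (i | i) <;> simp [blockVector]
    have h6 : μ ^ 2 = (s - 1) * μ + 1 := by
      have := h3 ⟨0, by omega⟩
      simp only [h2, h4, Finset.sum_const, Finset.card_univ, Fintype.card_fin,
        nsmul_eq_mul] at this
      apply mul_right_cancel₀ hb0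
      linear_combination -this
    -- The two roots of the quadratic have product `-1`, so the other one is `-1 / l`.
    have h7 : (μ - l) * (l * μ + 1) = 0 := by
      linear_combination l * h6 - μ * hl
    rcases mul_eq_zero.1 h7 with h8 | h8
    · have h8 : μ = l := by linarith
      exact ⟨by rw [h8, abs_of_pos hl0], Or.inr ⟨h8, b, h8 ▸ h5⟩⟩
    · have : |μ| ≤ 1 := abs_le.2 ⟨by nlinarith, by nlinarith⟩
      exact ⟨this.trans hl2, Or.inl (this.trans one_le_two)⟩

theorem sum_blockVector_sq (l b : ℝ) :
    ∑ i, blockVector s l b i ^ 2 = s * ((l ^ 2 + 1) * b ^ 2) := by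
  simp [blockVector, Fintype.sum_sum_type]
  ring

end BlockMatrix

/-! ### Flatness of the binomial distribution -/

section Binomial

/-- The weight of `k` in the binomial distribution with `t` trials, not normalized. -/
def binomialWeight (p q : ℝ) (t k : ℕ) : ℝ := t.choose k * p ^ (t - k) * q ^ k

theorem binomialWeight_succ (p q : ℝ) (t k : ℕ) :
    binomialWeight p q t (k + 1) * ((k + 1) * p) = binomialWeight p q t k * ((t - k) * q) := by
  unfold binomialWeight
  rcases lt_or_ge k t with h | h
  · have h1 : ((t.choose (k + 1) : ℕ) : ℝ) * (k + 1) = t.choose k * (t - k) := by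
      have := Nat.choose_succ_right_eq t k
      rw [← Nat.cast_sub h.le]
      exact_mod_cast this
    have h2 : t - k = (t - (k + 1)) + 1 := by omega
    rw [h2]
    linear_combination p ^ (t - (k + 1)) * p * q ^ (k + 1) * h1
  · rcases h.eq_or_lt with rfl | h
    · simp
    · simp [Nat.choose_eq_zero_of_lt h, Nat.choose_eq_zero_of_lt (h.trans k.lt_succ_self)]

variable {p q : ℝ} {t : ℕ}

theorem binomialWeight_nonneg (hp : 0 ≤ p) (hq : 0 ≤ q) (k : ℕ) :
    0 ≤ binomialWeight p q t k := by
  unfold binomialWeight; positivity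

theorem sum_binomialWeight_le (hp : 0 ≤ p) (hq : 0 ≤ q) (hpq : p + q = 1) (T : Finset ℕ) :
    ∑ k ∈ T, binomialWeight p q t k ≤ 1 := by
  have h : ∑ k ∈ range (t + 1), binomialWeight p q t k = 1 := by
    have := add_pow q p t
    rw [add_comm q p, hpq, one_pow] at this
    rw [this]
    exact sum_congr rfl fun k _ => by unfold binomialWeight; ring
  rw [← h]
  rw [← sum_filter_ne_zero]
  refine sum_le_sum_of_subset_of_nonneg (fun k hk => ?_)
    fun k _ _ => binomialWeight_nonneg hp hq k
  by_contra hk'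
  exact (mem_filter.1 hk).2
    (by simp [binomialWeight, Nat.choose_eq_zero_of_lt (by simpa using hk' : t < k)])

/-- Around its mode the binomial distribution is nearly constant over `s` consecutive values, so
that no weight is much more than `1 / s`. -/
theorem binomialWeight_le (hp : 0 < p) (hq : 0 < q) (hqp : q ≤ p) (hpq : p + q = 1) {s : ℕ}
    (hs : 1 ≤ s) (ht : 4 * (s : ℝ) ^ 2 + 1 ≤ t * q) (k : ℕ) :
    binomialWeight p q t k ≤ 2 / s := by
  have hs' : (1 : ℝ) ≤ s := by exact_mod_cast hs
  have hnn := binomialWeight_nonneg (t := t) hp.le hq.le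
  obtain ⟨m, hm, hmax⟩ := exists_max_image (range (t + 1)) (binomialWeight p q t) ⟨0, by simp⟩
  have hmt : m ≤ t := by simpa [Nat.lt_succ_iff] using hm
  have hmax (k : ℕ) : binomialWeight p q t k ≤ binomialWeight p q t m := by
    rcases lt_or_ge t k with h | h
    · refine le_trans (le_of_eq ?_) (hnn m)
      simp [binomialWeight, Nat.choose_eq_zero_of_lt h]
    · exact hmax k (by simpa [Nat.lt_succ_iff] using h)
  have hpos : 0 < binomialWeight p q t m := by
    have : 0 < t.choose m := Nat.choose_pos hmt
    unfold binomialWeight; positivity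
  -- Comparing the mode `m` with its two neighbours places it within 1 of `t * q`; hence `m ≥ 4 * s
  -- ^ 2`.
  have h1 : ((t : ℝ) - m) * q ≤ (m + 1) * p := by
    refine le_of_mul_le_mul_left ?_ hpos
    rw [← binomialWeight_succ]
    exact mul_le_mul_of_nonneg_right (hmax _) (by positivity)
  have h2 : (m : ℝ) * p ≤ (t - m + 1) * q := by
    rcases m with _ | m
    · simp; positivity
    · refine le_of_mul_le_mul_left ?_ hpos
      have h := binomialWeight_succ p q t m
      have h3 : (0 : ℝ) ≤ t - m := by
        have : (m : ℝ) + 1 ≤ t := by exact_mod_cast hmt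
        linarith
      push_cast
      rw [h, show (t : ℝ) - (m + 1) + 1 = t - m by ring]
      exact mul_le_mul_of_nonneg_right (hmax _) (by positivity)
  have hm4 : 4 * (s : ℝ) ^ 2 ≤ m := by nlinarith
  have hm0 : (0 : ℝ) < m := by nlinarith
  -- Consecutive weights beyond the mode have ratio at least `1 - 2 * (j + 1) / m`; multiplying
  -- these bounds costs at most the sum of the defects, `j * (j + 1) / m`.
  have key (j : ℕ) (hj : j ≤ s) :
      (1 - j * (j + 1) / m) * binomialWeight p q t m ≤ binomialWeight p q t (m + j) := by
    induction j with
    | zero => simp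
    | succ j ih =>
      have ih := ih (by omega)
      have hj' : (j : ℝ) + 1 ≤ s := by exact_mod_cast hj
      have hj0 : (0 : ℝ) ≤ j := j.cast_nonneg
      have h := binomialWeight_succ p q t (m + j)
      push_cast at h
      have hd : (0 : ℝ) < (m + j + 1) * p := by positivity
      have hb : 0 ≤ 1 - 2 * (j + 1 : ℝ) / m := by
        rw [sub_nonneg, div_le_one hm0]; nlinarith
      have hr : (1 - 2 * (j + 1 : ℝ) / m) * ((m + j + 1) * p) ≤ (t - (m + j)) * q := by
        have e1 : (1 - 2 * (j + 1 : ℝ) / m) * ((m + j + 1) * p) =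
            (m - (j + 1)) * p - 2 * (j + 1) ^ 2 / m * p := by
          field_simp; ring
        have e2 : 0 ≤ 2 * (j + 1 : ℝ) ^ 2 / m * p := by positivity
        rw [e1]
        nlinarith
      have h4 : (1 - 2 * (j + 1 : ℝ) / m) * binomialWeight p q t (m + j) ≤
          binomialWeight p q t (m + (j + 1)) := by
        refine le_of_mul_le_mul_right ?_ hd
        rw [← add_assoc, h]
        nlinarith [mul_le_mul_of_nonneg_left hr (hnn (m + j))]
      refine le_trans ?_ h4
      refine le_trans ?_ (mul_le_mul_of_nonneg_left ih hb)
      rw [← mul_assoc]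
      refine mul_le_mul_of_nonneg_right ?_ hpos.le
      have e3 : (1 - 2 * (j + 1 : ℝ) / m) * (1 - j * (j + 1) / m) =
          1 - (j + 1) * (j + 1 + 1) / m + 2 * (j + 1) / m * (j * (j + 1) / m) := by
        ring
      have e4 : 0 ≤ 2 * (j + 1 : ℝ) / m * (j * (j + 1) / m) := by positivity
      push_cast
      rw [e3]
      linarith
  have hsum := sum_binomialWeight_le (t := t) hp.le hq.le hpq ((range s).map (addLeftEmbedding m))
  rw [sum_map] at hsum
  -- As `m ≥ 4 * s ^ 2`, each of these `s` weights is at least half the maximum, while their sum is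
  -- at most 1.
  have hlow : ∑ j ∈ range s, 1 / 2 * binomialWeight p q t m ≤
      ∑ j ∈ range s, binomialWeight p q t (addLeftEmbedding m j) := by
    refine sum_le_sum fun j hj => ?_
    have hj : j < s := by simpa using hj
    refine le_trans (mul_le_mul_of_nonneg_right ?_ hpos.le) (key j hj.le)
    have hj' : (j : ℝ) ≤ s := by exact_mod_cast hj.le
    have hj0 : (0 : ℝ) ≤ j := j.cast_nonneg
    have : (j : ℝ) * (j + 1) / m ≤ 1 / 2 := by
      rw [div_le_iff₀ hm0]; nlinarith
    linarith
  rw [sum_const, card_range, nsmul_eq_mul] at hlow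
  refine (hmax k).trans ?_
  rw [le_div_iff₀ (by positivity)]
  linarith

end Binomial

/-! ### Distribution of the principal eigenvector over the levels -/

section Level

variable {s t : ℕ}

/-- The number of coordinates that lie in the second block. -/
def level (x : Fin t → Fin s ⊕ Fin s) : ℕ := #{i | (x i).isRight}

theorem prod_ite_isRight {M : Type*} [CommMonoid M] (x : Fin t → Fin s ⊕ Fin s) (c : M) :
    ∏ i, (if (x i).isRight then c else 1) = c ^ level x := by
  rw [prod_ite]
  simp [level]

/-- Moving one coordinate to the second block divides the entry by `l`, so the product depends on
the level alone. -/
theorem prod_blockVector_mul_pow (l b : ℝ) (x : Fin t → Fin s ⊕ Fin s) :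
    (∏ i, blockVector s l b (x i)) * l ^ level x = (l * b) ^ t := by
  rw [← prod_ite_isRight, ← prod_mul_distrib]
  have (i : Fin t) : blockVector s l b (x i) * (if (x i).isRight then l else 1) = l * b := by
    rcases x i with a | a <;> simp [blockVector, mul_comm]
  simp [this]

-- Mark the level by a formal variable: the generating polynomial of the squared entries factors
-- over the coordinates as `(q * X + p) ^ t`, and coefficients are compared.
open Polynomial in
theorem sum_level_eq (l b : ℝ) (k : ℕ) :
    ∑ x : Fin t → Fin s ⊕ Fin s with level x = k, (∏ i, blockVector s l b (x i)) ^ 2 =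
      binomialWeight (s * (l * b) ^ 2) (s * b ^ 2) t k := by
  set p := (s : ℝ) * (l * b) ^ 2
  set q := (s : ℝ) * b ^ 2
  have h : ∑ x : Fin t → Fin s ⊕ Fin s,
      C ((∏ i, blockVector s l b (x i)) ^ 2) * X ^ level x = (C q * X + C p) ^ t := by
    have h1 : C q * X + C p = ∑ a : Fin s ⊕ Fin s,
        C (blockVector s l b a ^ 2) * (if a.isRight then X else 1) := by
      rw [Fintype.sum_sum_type]
      simp only [blockVector, Sum.elim_inl, Sum.elim_inr, Sum.isRight_inl, Sum.isRight_inr,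
        sum_const, card_univ, Fintype.card_fin, p, q]
      simp
      ring
    have h2 : (C q * X + C p) ^ t = ∏ _i : Fin t, (C q * X + C p) := by simp
    rw [h2, h1, prod_univ_sum, Fintype.piFinset_univ]
    refine sum_congr rfl fun x _ => ?_
    rw [prod_mul_distrib, prod_ite_isRight, ← map_prod, prod_pow]
  have h3 := congrArg (fun P : ℝ[X] => P.coeff k) h
  simp only [finsetSum_coeff, coeff_C_mul, coeff_X_pow, mul_ite, mul_one, mul_zero] at h3
  rw [sum_filter]
  simp only [eq_comm (a := k)] at h3
  rw [h3, add_pow, finsetSum_coeff]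
  have h4 (m : ℕ) : ((C q * X) ^ m * C p ^ (t - m) * (t.choose m : ℝ[X])).coeff k =
      if k = m then binomialWeight p q t m else 0 := by
    have : (C q * X) ^ m * C p ^ (t - m) * (t.choose m : ℝ[X]) =
        C (binomialWeight p q t m) * X ^ m := by
      simp only [binomialWeight, map_mul, map_pow, map_natCast]
      ring
    rw [this, coeff_C_mul, coeff_X_pow]
    simp
  simp only [h4, sum_ite_eq, mem_range, ite_eq_left_iff, not_lt]
  intro hk
  simp [binomialWeight, Nat.choose_eq_zero_of_lt (Nat.lt_of_succ_le hk)]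

/-- The principal eigenvector of the tensor power is nearly orthogonal to normalized
indicators, when the binomial weights are small. -/
theorem sq_sum_prod_blockVector_le {l b P : ℝ} (hl : 3 / 2 ≤ l) (hb : 0 < b)
    (hP : ∀ k, binomialWeight (s * (l * b) ^ 2) (s * b ^ 2) t k ≤ P)
    (X : Finset (Fin t → Fin s ⊕ Fin s)) :
    (∑ x ∈ X, ∏ i, blockVector s l b (x i)) ^ 2 ≤ 6 * P * #X := by
  set v : (Fin t → Fin s ⊕ Fin s) → ℝ := fun x => ∏ i, blockVector s l b (x i) with hv
  have hl0 : 0 < l := by linarith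
  have hv0 (x) : 0 < v x := by
    refine prod_pos fun i _ => ?_
    rcases x i with a | a <;> simp [blockVector] <;> positivity
  have hP0 : 0 ≤ P := by
    refine le_trans ?_ (hP 0)
    exact binomialWeight_nonneg (by positivity) (by positivity) _
  -- For `x` at level `k ≤ K`, `v y` equals `v x * l ^ k / l ^ K`. Grouping by level turns the sum
  -- into binomial weights damped geometrically below `K`.
  have inner (y) : ∑ x with level x ≤ level y, v x * v y ≤ 3 * P := by
    set K := level y
    have h1 (x) : v x * v y = v x ^ 2 * l ^ level x / l ^ K := by
      rw [eq_div_iff (by positivity)]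
      have h2 : v x * l ^ level x = v y * l ^ K := by
        simp only [hv, K, prod_blockVector_mul_pow]
      linear_combination -v x * h2
    have h2 : ∑ x with level x ≤ K, v x * v y =
        ∑ k ∈ range (K + 1), binomialWeight (s * (l * b) ^ 2) (s * b ^ 2) t k * (l ^ k / l ^ K) := by
      rw [← sum_fiberwise_of_maps_to (s := univ.filter fun x => level x ≤ K)
        (t := range (K + 1)) (g := level) (fun x hx => by
          simpa [Nat.lt_succ_iff] using hx)]
      refine sum_congr rfl fun k hk => ?_
      have hk : k ≤ K := by simpa [Nat.lt_succ_iff] using hk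
      rw [← sum_level_eq, sum_mul, filter_filter]
      refine sum_congr ?_ fun x hx => ?_
      · ext x
        simp only [mem_filter, mem_univ, true_and]
        exact ⟨fun h => h.2, fun h => ⟨h ▸ hk, h⟩⟩
      · have hx : level x = k := by simpa using hx
        rw [h1, hx, mul_div_assoc]
    rw [h2]
    -- The geometric sum is below `l / (l - 1)`, which is at most 3 because `l ≥ 3 / 2`.
    have h3 : ∑ k ∈ range (K + 1), l ^ k / l ^ K ≤ 3 := by
      rw [← sum_div, div_le_iff₀ (by positivity)]
      have h4 := geom_sum_mul l (K + 1)
      have h5 : 0 < l ^ K := by positivity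
      rw [pow_succ] at h4
      nlinarith
    calc _ ≤ ∑ k ∈ range (K + 1), P * (l ^ k / l ^ K) :=
          sum_le_sum fun k _ => mul_le_mul_of_nonneg_right (hP k) (by positivity)
      _ ≤ 3 * P := by rw [← mul_sum]; nlinarith
  have half : ∑ y ∈ X, ∑ x ∈ X, (if level x ≤ level y then v x * v y else 0) ≤ 3 * P * #X := by
    rw [mul_comm, ← nsmul_eq_mul]
    refine sum_le_card_nsmul _ _ _ fun y _ => le_trans ?_ (inner y)
    rw [sum_filter]
    refine sum_le_sum_of_subset_of_nonneg (subset_univ _) fun x _ _ => ?_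
    split_ifs
    · exact (mul_pos (hv0 x) (hv0 y)).le
    · rfl
  have half' : ∑ y ∈ X, ∑ x ∈ X, (if level y ≤ level x then v x * v y else 0) ≤ 3 * P * #X := by
    rw [sum_comm]
    refine le_trans (le_of_eq ?_) half
    exact sum_congr rfl fun y _ => sum_congr rfl fun x _ => by rw [mul_comm (v y)]
  calc (∑ x ∈ X, v x) ^ 2 = ∑ y ∈ X, ∑ x ∈ X, v x * v y := by
        rw [sq, sum_mul_sum, sum_comm]
    _ ≤ ∑ y ∈ X, ∑ x ∈ X, ((if level x ≤ level y then v x * v y else 0) +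
          (if level y ≤ level x then v x * v y else 0)) := by
        refine sum_le_sum fun y _ => sum_le_sum fun x _ => ?_
        have := (mul_pos (hv0 x) (hv0 y)).le
        rcases le_total (level x) (level y) with h | h <;> rw [if_pos h] <;> split_ifs <;> linarith
    _ ≤ 6 * P * #X := by
        simp only [sum_add_distrib]; linarith

end Level

/-! ### Spectral bound for edge counts -/

section Bilinear

variable {s t : ℕ}

/-- The spectral bound for the number of edges between two sets of vertices. -/
theorem sum_kroneckerPower_blockMatrix_le {l b P : ℝ} (hs : 2 ≤ s) (hl : 3 / 2 ≤ l)
    (hls : l ^ 2 = (s - 1) * l + 1) (hb : 0 < b) (hb1 : s * ((l ^ 2 + 1) * b ^ 2) = 1)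
    (hP : ∀ k, binomialWeight (s * (l * b) ^ 2) (s * b ^ 2) t k ≤ P) (ht : t ≠ 0)
    (X Y : Finset (Fin t → Fin s ⊕ Fin s)) :
    ∑ x ∈ X, ∑ y ∈ Y, kroneckerPower (blockMatrix s) t x y ≤
      (6 * P + 2 / l) * l ^ t * √(#X * #Y) := by
  classical
  obtain ⟨U, e, hU1, hU2, hA, hUe⟩ := (blockMatrix_isHermitian s).exists_eigenvector_matrix
  have hl0 : 0 < l := by linarith
  have hP0 : 0 ≤ P := le_trans (binomialWeight_nonneg (by positivity) (by positivity) 0) (hP 0)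
  have hcol (j j') : ∑ x, U x j * U x j' = if j = j' then 1 else 0 := by
    have := congrFun (congrFun hU2 j) j'
    simpa [Matrix.mul_apply, Matrix.one_apply] using this
  have hspec (j) := blockMatrix_eigenvector hs hl0 hls (μ := e j) (f := fun i => U i j)
    (fun h0 => by
      have := hcol j j
      simp only [fun x => congrFun h0 x] at this
      simp at this) (hUe j)
  -- `F J X` is the coefficient of the indicator of `X` along the tensor eigenvector indexed by `J`.
  set F : (Fin t → Fin s ⊕ Fin s) → Finset (Fin t → Fin s ⊕ Fin s) → ℝ := fun J X =>
    ∑ x ∈ X, ∏ i, U (x i) (J i) with hF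
  set ind : Finset (Fin t → Fin s ⊕ Fin s) → (Fin t → Fin s ⊕ Fin s) → ℝ := fun X x =>
    if x ∈ X then 1 else 0 with hind
  have hvec (J X) : Matrix.vecMul (ind X) (kroneckerPower U t) J = F J X := by
    simp [Matrix.vecMul, dotProduct, hind, hF, kroneckerPower]
  have hsq (X) : ∑ J, F J X ^ 2 = #X := by
    simp only [← hvec]
    rw [sum_vecMul_kroneckerPower_sq hU1]
    simp [dotProduct, hind]
  have hsum : ∑ x ∈ X, ∑ y ∈ Y, kroneckerPower (blockMatrix s) t x y =
      ∑ J, (∏ i, e (J i)) * (F J X * F J Y) := by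
    have := dotProduct_kroneckerPower_mulVec hA t (ind X) (ind Y)
    simp only [hvec] at this
    rw [← this]
    simp [dotProduct, Matrix.mulVec, hind]
  set T : Finset (Fin t → Fin s ⊕ Fin s) := {J | ∀ i, ¬ |e (J i)| ≤ 2} with hT
  have hvect (j) (hj : ¬ |e j| ≤ 2) : ∃ c, (fun i => U i j) = blockVector s l c ∧ |c| = b := by
    obtain ⟨-, c, hc⟩ := (hspec j).2.resolve_left hj
    refine ⟨c, hc, ?_⟩
    have h1 : s * ((l ^ 2 + 1) * c ^ 2) = 1 := by
      rw [← sum_blockVector_sq, ← hc]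
      simpa [sq] using hcol j j
    have h2 : c ^ 2 = b ^ 2 := by
      have h3 : (s : ℝ) * (l ^ 2 + 1) ≠ 0 := by
        have : (0 : ℝ) < s := by exact_mod_cast (by omega : 0 < s)
        positivity
      apply mul_left_cancel₀ h3
      linarith
    rw [← abs_of_pos hb]
    exact (sq_eq_sq_iff_abs_eq_abs _ _).1 h2
  -- Eigenvectors with `|e j| > 2` are all nonzero multiples of one vector, so orthogonality allows
  -- only one such index per coordinate. For small `l` there may be none.
  have hT1 : #T ≤ 1 := by
    refine card_le_one.2 fun J hJ J' hJ' => funext fun i => ?_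
    by_contra hne
    obtain ⟨c, hc, hcb⟩ := hvect (J i) ((mem_filter.1 hJ).2 i)
    obtain ⟨c', hc', hcb'⟩ := hvect (J' i) ((mem_filter.1 hJ').2 i)
    have h1 := hcol (J i) (J' i)
    rw [if_neg hne] at h1
    simp only [fun x => congrFun hc x, fun x => congrFun hc' x] at h1
    have h2 : ((s : ℝ) * (l ^ 2 + 1)) * (c * c') = 0 := by
      rw [← h1]
      simp [blockVector, Fintype.sum_sum_type]
      ring
    have hc0 : c ≠ 0 := abs_pos.1 (hcb ▸ hb)
    have hc0' : c' ≠ 0 := abs_pos.1 (hcb' ▸ hb)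
    have h3 : (0 : ℝ) < s := by exact_mod_cast (by omega : 0 < s)
    have h4 : (0 : ℝ) < s * (l ^ 2 + 1) := by positivity
    simp [h4.ne', hc0, hc0'] at h2
  have hFT (J) (hJ : J ∈ T) (X) : |F J X| ≤ √(6 * P * #X) := by
    refine Real.le_sqrt_of_sq_le ?_
    refine le_trans ?_ (sq_sum_prod_blockVector_le hl hb hP X)
    refine pow_le_pow_left₀ (abs_nonneg _) ((abs_sum_le_sum_abs _ _).trans_eq ?_) 2
    refine sum_congr rfl fun x _ => ?_
    rw [abs_prod]
    refine prod_congr rfl fun i _ => ?_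
    obtain ⟨c, hc, hcb⟩ := hvect (J i) ((mem_filter.1 hJ).2 i)
    rw [congrFun hc (x i), ← hcb]
    rcases x i with a | a <;> simp [blockVector, abs_mul, abs_of_pos hl0]
  have hE (J : Fin t → Fin s ⊕ Fin s) : |∏ i, e (J i)| ≤ l ^ t := by
    rw [abs_prod]
    refine (prod_le_prod (fun i _ => abs_nonneg _) fun i _ => (hspec (J i)).1).trans_eq ?_
    simp
  have hE' (J) (hJ : J ∉ T) : |∏ i, e (J i)| ≤ 2 / l * l ^ t := by
    have : ∃ i, |e (J i)| ≤ 2 := by simpa [hT] using hJ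
    obtain ⟨i, hi⟩ := this
    rw [abs_prod, ← mul_prod_erase _ _ (mem_univ i)]
    have h1 : ∏ i ∈ univ.erase i, |e (J i)| ≤ l ^ (t - 1) := by
      refine (prod_le_prod (fun i _ => abs_nonneg _) fun i _ => (hspec (J i)).1).trans_eq ?_
      simp
    have h2 : 2 / l * l ^ t = 2 * l ^ (t - 1) := by
      rw [← mul_pow_sub_one ht l]; field_simp
    rw [h2]
    exact mul_le_mul hi h1 (prod_nonneg fun i _ => abs_nonneg _) (by norm_num)
  have hCS : ∑ J, |F J X| * |F J Y| ≤ √(#X * #Y) := by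
    have := Real.sum_mul_le_sqrt_mul_sqrt univ (fun J => |F J X|) fun J => |F J Y|
    simpa only [sq_abs, hsq, ← Real.sqrt_mul (Nat.cast_nonneg _)] using this
  have hTsum : ∑ J ∈ T, |F J X| * |F J Y| ≤ 6 * P * √(#X * #Y) := by
    have h1 : ∀ J ∈ T, |F J X| * |F J Y| ≤ 6 * P * √(#X * #Y) := fun J hJ => by
      refine (mul_le_mul (hFT J hJ X) (hFT J hJ Y) (abs_nonneg _) (Real.sqrt_nonneg _)).trans_eq ?_
      rw [← Real.sqrt_mul (by positivity),
        show 6 * P * #X * (6 * P * #Y) = (6 * P) ^ 2 * (#X * #Y) by ring,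
        Real.sqrt_mul (by positivity), Real.sqrt_sq (by positivity)]
    refine (sum_le_card_nsmul _ _ _ h1).trans ?_
    rw [nsmul_eq_mul]
    exact mul_le_of_le_one_left (by positivity) (by exact_mod_cast hT1)
  -- Every term, principal or not, gets the weak bound, so that Cauchy–Schwarz applies to the full
  -- sum; the principal term is added on top.
  have hterm (J) : (∏ i, e (J i)) * (F J X * F J Y) ≤
      2 / l * l ^ t * (|F J X| * |F J Y|) +
        (if J ∈ T then l ^ t * (|F J X| * |F J Y|) else 0) := by
    have h0 : 0 ≤ |F J X| * |F J Y| := by positivity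
    have h1 : 0 ≤ 2 / l * l ^ t * (|F J X| * |F J Y|) := by positivity
    refine (le_abs_self _).trans ?_
    rw [abs_mul, abs_mul]
    split_ifs with hJ
    · linarith [mul_le_mul_of_nonneg_right (hE J) h0]
    · linarith [mul_le_mul_of_nonneg_right (hE' J hJ) h0]
  rw [hsum]
  refine (sum_le_sum fun J _ => hterm J).trans ?_
  rw [sum_add_distrib, ← mul_sum, sum_ite_mem, univ_inter, ← mul_sum]
  have h1 : 0 ≤ 2 / l * l ^ t := by positivity
  have h2 : 0 ≤ l ^ t := by positivity
  linarith [mul_le_mul_of_nonneg_left hCS h1, mul_le_mul_of_nonneg_left hTsum h2]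

end Bilinear

/-! ### The tensor graph and its two parameters -/

section TensorGraph

theorem blockMatrix_apply_eq_zero_or_one {s : ℕ} (i j : Fin s ⊕ Fin s) :
    blockMatrix s i j = 0 ∨ blockMatrix s i j = 1 := by
  rcases i with i | i <;> rcases j with j | j <;>
    simp [blockMatrix, Matrix.one_apply] <;> grind

theorem kroneckerPower_blockMatrix_apply_eq_zero_or_one {s t : ℕ} (x y : Fin t → Fin s ⊕ Fin s) :
    kroneckerPower (blockMatrix s) t x y = 0 ∨ kroneckerPower (blockMatrix s) t x y = 1 := by
  simp only [kroneckerPower, Matrix.of_apply]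
  by_cases h : ∃ i, blockMatrix s (x i) (y i) = 0
  · obtain ⟨i, hi⟩ := h
    exact Or.inl (prod_eq_zero (mem_univ i) hi)
  · push Not at h
    exact Or.inr (prod_eq_one fun i _ => (blockMatrix_apply_eq_zero_or_one _ _).resolve_left (h i))

/-- One zero diagonal factor makes a diagonal entry of the power vanish. This needs `t ≠ 0`, since
the zeroth power is the matrix `(1)`. -/
theorem realAdjMatrix_tensorGraph (s : ℕ) {t : ℕ} (ht : t ≠ 0) :
    realAdjMatrix (tensorGraph s t) = kroneckerPower (blockMatrix s) t := by
  classical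
  have hsymm (x y : Fin t → Fin s ⊕ Fin s) : kroneckerPower (blockMatrix s) t y x =
      kroneckerPower (blockMatrix s) t x y := by
    simp only [kroneckerPower, Matrix.of_apply]
    exact prod_congr rfl fun i _ => by simpa using (blockMatrix_isHermitian s).apply (x i) (y i)
  have hdiag (x : Fin t → Fin s ⊕ Fin s) : kroneckerPower (blockMatrix s) t x x = 0 := by
    simp only [kroneckerPower, Matrix.of_apply]
    refine prod_eq_zero (mem_univ ⟨0, Nat.pos_of_ne_zero ht⟩) ?_
    rcases x ⟨0, Nat.pos_of_ne_zero ht⟩ with a | a <;> simp [blockMatrix]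
  ext x y
  rw [realAdjMatrix, SimpleGraph.adjMatrix_apply]
  simp only [tensorGraph, SimpleGraph.fromRel_adj, hsymm x y, or_self]
  rcases kroneckerPower_blockMatrix_apply_eq_zero_or_one x y with h | h
  · simp [h]
  · have hne : x ≠ y := by
      rintro rfl
      rw [hdiag] at h
      exact zero_ne_one h
    simp [h, hne]

theorem edgeCount_eq_sum {V : Type*} (G : SimpleGraph V) (X Y : Finset V) :
    (edgeCount G X Y : ℝ) = ∑ x ∈ X, ∑ y ∈ Y, realAdjMatrix G x y := by
  classical
  simp only [edgeCount, SimpleGraph.interedges, Rel.interedges, realAdjMatrix,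
    SimpleGraph.adjMatrix_apply, card_filter, sum_product]
  push_cast
  exact sum_congr rfl fun x _ => sum_congr rfl fun y _ => by congr

theorem exists_blockMatrix_eigenvalue {s : ℕ} (hs : 2 ≤ s) :
    ∃ l : ℝ, 3 / 2 ≤ l ∧ s / 2 ≤ l ∧ l ≤ s ∧ l ^ 2 = (s - 1) * l + 1 := by
  have hs' : (2 : ℝ) ≤ s := by exact_mod_cast hs
  obtain ⟨l, hl0, hl⟩ : ∃ l : ℝ, (s - 1 : ℝ) ≤ l ∧ l ^ 2 = (s - 1) * l + 1 := by
    have h1 : √((s - 1 : ℝ) ^ 2 + 4) ^ 2 = (s - 1 : ℝ) ^ 2 + 4 := Real.sq_sqrt (by positivity)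
    have h2 : (s - 1 : ℝ) ≤ √((s - 1 : ℝ) ^ 2 + 4) := Real.le_sqrt_of_sq_le (by linarith)
    exact ⟨((s - 1) + √((s - 1 : ℝ) ^ 2 + 4)) / 2, by linarith, by linear_combination h1 / 4⟩
  exact ⟨l, by nlinarith, by linarith, by nlinarith, hl⟩

theorem pow_le_largestEigenvalue {s t : ℕ} (hs : 2 ≤ s) (ht : t ≠ 0) {l : ℝ}
    (hl : l ^ 2 = (s - 1) * l + 1) : l ^ t ≤ largestEigenvalue (tensorGraph s t) := by
  have : Nonempty (Fin s) := ⟨⟨0, by omega⟩⟩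
  refine (isGreatest_largestEigenvalue (tensorGraph s t)).2 ?_
  rw [Set.mem_ofPred_eq, realAdjMatrix_tensorGraph s ht]
  refine Module.End.hasEigenvalue_of_hasEigenvector
    (x := fun x => ∏ i, blockVector s l 1 (x i)) ⟨?_, fun h => ?_⟩
  · rw [Module.End.mem_eigenspace_iff, Matrix.mulVecLin_apply, kroneckerPower_mulVec_prod,
      blockMatrix_mulVec_blockVector hl]
    ext x
    simp [prod_mul_distrib]
  · have := congrFun h fun _ => Sum.inr (Classical.arbitrary _)
    simp [blockVector] at this

theorem largestEigenvalue_tensorGraph_pos {s t : ℕ} (hs : 2 ≤ s) (ht : t ≠ 0) :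
    0 < largestEigenvalue (tensorGraph s t) := by
  obtain ⟨l, hl1, -, -, hl⟩ := exists_blockMatrix_eigenvalue hs
  have hl0 : 0 < l := by linarith
  exact (pow_pos hl0 t).trans_le (pow_le_largestEigenvalue hs ht hl)

theorem maxBiAverageDegree_tensorGraph_le {s : ℕ} (hs : 2 ≤ s) :
    maxBiAverageDegree (tensorGraph s (s ^ 8)) ≤
      16 / s * largestEigenvalue (tensorGraph s (s ^ 8)) := by
  have : Nonempty (Fin s) := ⟨⟨0, by omega⟩⟩
  have ht : s ^ 8 ≠ 0 := pow_ne_zero _ (by omega)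
  have hs' : (2 : ℝ) ≤ s := by exact_mod_cast hs
  obtain ⟨l, hl1, hl2, hl3, hl⟩ := exists_blockMatrix_eigenvalue hs
  have hl0 : 0 < l := by linarith
  obtain ⟨b, hb, hb1⟩ : ∃ b : ℝ, 0 < b ∧ s * ((l ^ 2 + 1) * b ^ 2) = 1 := by
    refine ⟨√(1 / (s * (l ^ 2 + 1))), by positivity, ?_⟩
    rw [Real.sq_sqrt (by positivity)]
    field_simp
  -- Here `q = 1 / (l ^ 2 + 1)` is at least `1 / (s ^ 2 + 1)`, so `t = s ^ 8` makes the mean `t * q`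
  -- large enough.
  have hP : ∀ k, binomialWeight (s * (l * b) ^ 2) (s * b ^ 2) (s ^ 8) k ≤ 2 / s := by
    refine binomialWeight_le (by positivity) (by positivity) ?_ ?_ (by omega) ?_
    · rw [mul_pow]
      have : 0 < s * b ^ 2 := by positivity
      nlinarith
    · linear_combination hb1
    · have h1 : s * b ^ 2 = 1 / (l ^ 2 + 1) := by
        rw [eq_div_iff (by positivity)]; linarith
      have h2 : (l ^ 2 + 1 : ℝ) ≤ s ^ 2 + 1 := by nlinarith
      rw [h1, mul_one_div, le_div_iff₀ (by positivity)]
      push_cast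
      have h3 : (4 : ℝ) ≤ s ^ 2 := by nlinarith
      refine (mul_le_mul_of_nonneg_left h2 (by positivity)).trans ?_
      rw [show (s : ℝ) ^ 8 = (s ^ 2) ^ 4 by ring]
      generalize (s : ℝ) ^ 2 = r at h3
      have h4 : 16 ≤ r ^ 2 := by nlinarith
      have h5 : 16 * r ^ 2 ≤ r ^ 4 := by nlinarith
      nlinarith
  obtain ⟨X, Y, hX, hY, hXY⟩ := (isGreatest_maxBiAverageDegree (tensorGraph s (s ^ 8))).1
  have hXY0 : 0 < √((#X : ℝ) * #Y) := by
    have := hX.card_pos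
    have := hY.card_pos
    positivity
  rw [hXY, div_le_iff₀ hXY0, edgeCount_eq_sum, realAdjMatrix_tensorGraph s ht]
  refine (sum_kroneckerPower_blockMatrix_le hs hl1 hl hb hb1 hP ht X Y).trans ?_
  refine mul_le_mul_of_nonneg_right ?_ hXY0.le
  refine mul_le_mul ?_ (pow_le_largestEigenvalue hs ht hl) (by positivity) (by positivity)
  have h1 : 2 / l ≤ 4 / s := by
    rw [div_le_div_iff₀ hl0 (by positivity)]; linarith
  calc 6 * (2 / (s : ℝ)) + 2 / l ≤ 6 * (2 / s) + 4 / s := by linarith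
    _ = 16 / s := by ring

end TensorGraph

/-! ### Comparing `s` with the order of the graph -/

section Order

theorem log_order_bounds {s : ℕ} (hs : 2 ≤ s) :
    0 < Real.log (((2 * s) ^ s ^ 8 : ℕ) : ℝ) ∧
    0 < Real.log (Real.log (((2 * s) ^ s ^ 8 : ℕ) : ℝ)) ∧
    Real.log (((2 * s) ^ s ^ 8 : ℕ) : ℝ) ≤
      s ^ 8 * Real.log (Real.log (((2 * s) ^ s ^ 8 : ℕ) : ℝ)) := by
  have hs' : (2 : ℝ) ≤ s := by exact_mod_cast hs
  have hs0 : (0 : ℝ) < s := by linarith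
  have hlog2 : (1 / 2 : ℝ) < Real.log 2 := by linarith [Real.log_two_gt_d9]
  have hlogs : Real.log 2 ≤ Real.log s := Real.log_le_log two_pos hs'
  have h2s : Real.log (2 * s) = Real.log 2 + Real.log s := Real.log_mul two_ne_zero hs0.ne'
  have hL : Real.log (((2 * s) ^ s ^ 8 : ℕ) : ℝ) = s ^ 8 * Real.log (2 * s) := by
    push_cast
    rw [Real.log_pow]
    push_cast
    rfl
  have h1 : 1 ≤ Real.log (2 * s) := by linarith
  -- The factor `s ^ 8` alone gives `8 * log s ≥ log (2 * s)`; the iterated logarithm left over is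
  -- nonnegative because `log (2 * s) ≥ 1`.
  have hLL : Real.log (2 * s) ≤ Real.log (s ^ 8 * Real.log (2 * s)) := by
    rw [Real.log_mul (pow_ne_zero 8 hs0.ne') (by linarith), Real.log_pow]
    have := Real.log_nonneg h1
    push_cast
    linarith
  rw [hL]
  exact ⟨by positivity, by linarith, mul_le_mul_of_nonneg_left hLL (by positivity)⟩

theorem rpow_one_div_eight {s : ℝ} (hs : 0 ≤ s) : (s ^ 8) ^ (1 / 8 : ℝ) = s := by
  rw [← Real.rpow_natCast, ← Real.rpow_mul hs]
  norm_num

theorem one_div_le_rpow_log {s : ℕ} (hs : 2 ≤ s) :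
    1 / (s : ℝ) ≤ (Real.log (Real.log (((2 * s) ^ s ^ 8 : ℕ) : ℝ)) /
      Real.log (((2 * s) ^ s ^ 8 : ℕ) : ℝ)) ^ (1 / 8 : ℝ) := by
  obtain ⟨h1, h2, h3⟩ := log_order_bounds hs
  have hs0 : (0 : ℝ) < s := by exact_mod_cast (by omega : 0 < s)
  rw [← rpow_one_div_eight (by positivity : 0 ≤ 1 / (s : ℝ))]
  refine Real.rpow_le_rpow (by positivity) ?_ (by norm_num)
  rw [le_div_iff₀ h1, one_div, inv_pow, inv_mul_le_iff₀ (by positivity)]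
  exact h3

theorem rpow_log_le {s : ℕ} (hs : 2 ≤ s) :
    (Real.log (((2 * s) ^ s ^ 8 : ℕ) : ℝ) /
      Real.log (Real.log (((2 * s) ^ s ^ 8 : ℕ) : ℝ))) ^ (1 / 8 : ℝ) ≤ s := by
  obtain ⟨h1, h2, h3⟩ := log_order_bounds hs
  conv_rhs => rw [← rpow_one_div_eight (Nat.cast_nonneg s)]
  refine Real.rpow_le_rpow (by positivity) ?_ (by norm_num)
  rwa [div_le_iff₀ h2]

theorem le_two_mul_pow_pow {s : ℕ} (hs : 2 ≤ s) : s ≤ (2 * s) ^ s ^ 8 :=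
  calc s ≤ (2 * s) ^ 1 := by rw [pow_one]; omega
    _ ≤ (2 * s) ^ s ^ 8 := Nat.pow_le_pow_right (by omega) (Nat.one_le_pow _ _ (by omega))

theorem card_tensorGraph_vertices (s t : ℕ) :
    Fintype.card (Fin t → Fin s ⊕ Fin s) = (2 * s) ^ t := by
  simp [two_mul]

end Order

/-! ### Asymptotic consequences -/

open Filter in
theorem maxBiAverageDegree_tensorGraph_isLittleO :
    (fun s : ℕ => maxBiAverageDegree (tensorGraph s (s ^ 8)))
      =o[atTop] (fun s : ℕ => largestEigenvalue (tensorGraph s (s ^ 8))) := by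
  rw [Asymptotics.isLittleO_iff]
  intro c hc
  filter_upwards [eventually_ge_atTop 2, eventually_ge_atTop ⌈16 / c⌉₊] with s hs hsc
  have : Nonempty (Fin s) := ⟨⟨0, by omega⟩⟩
  have hs0 : (0 : ℝ) < s := by exact_mod_cast (by omega : 0 < s)
  have hpos := largestEigenvalue_tensorGraph_pos (t := s ^ 8) hs (pow_ne_zero _ (by omega))
  have hM : 0 ≤ maxBiAverageDegree (tensorGraph s (s ^ 8)) := by
    obtain ⟨X, Y, -, -, h⟩ := (isGreatest_maxBiAverageDegree (tensorGraph s (s ^ 8))).1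
    rw [h]
    positivity
  rw [Real.norm_of_nonneg hM, Real.norm_of_nonneg hpos.le]
  refine (maxBiAverageDegree_tensorGraph_le hs).trans (mul_le_mul_of_nonneg_right ?_ hpos.le)
  rw [div_le_iff₀ hs0, ← div_le_iff₀' hc]
  exact (Nat.le_ceil _).trans (by exact_mod_cast hsc)

open Filter in
theorem not_isLittleO_of_largestEigenvalue_le {f : ℕ → ℝ}
    (hf : ∀ (V : Type) [Fintype V] [Nonempty V] (G : SimpleGraph V),
      largestEigenvalue G ≤ f (Fintype.card V) * maxBiAverageDegree G) :
    ¬ f =o[atTop] (fun n : ℕ => (Real.log n / Real.log (Real.log n)) ^ (1 / 8 : ℝ)) := by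
  intro ho
  rw [Asymptotics.isLittleO_iff] at ho
  have htend : Tendsto (fun s : ℕ => (2 * s) ^ s ^ 8) atTop atTop := by
    refine tendsto_atTop_mono' _ ?_ tendsto_id
    filter_upwards [eventually_ge_atTop 2] with s hs using le_two_mul_pow_pow hs
  -- With `1 / 32`, the factor `s / 32` times the ratio `16 / s` is `1 / 2`, contradicting
  -- positivity of the eigenvalue.
  have hev := htend.eventually (ho (c := 1 / 32) (by norm_num))
  obtain ⟨s, hbound, hs⟩ := (hev.and (eventually_ge_atTop 2)).exists
  have : Nonempty (Fin s) := ⟨⟨0, by omega⟩⟩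
  have hs0 : (0 : ℝ) < s := by exact_mod_cast (by omega : 0 < s)
  obtain ⟨h1, h2, -⟩ := log_order_bounds hs
  rw [Real.norm_of_nonneg (Real.rpow_nonneg (div_pos h1 h2).le (1 / 8))] at hbound
  have hfs : |f ((2 * s) ^ s ^ 8)| ≤ s / 32 := by
    refine hbound.trans ?_
    linarith [rpow_log_le hs]
  have hpos := largestEigenvalue_tensorGraph_pos (t := s ^ 8) hs (pow_ne_zero _ (by omega))
  have hM := maxBiAverageDegree_tensorGraph_le hs
  have hM0 : 0 ≤ maxBiAverageDegree (tensorGraph s (s ^ 8)) := by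
    obtain ⟨X, Y, -, -, h⟩ := (isGreatest_maxBiAverageDegree (tensorGraph s (s ^ 8))).1
    rw [h]
    positivity
  have key := hf _ (tensorGraph s (s ^ 8))
  rw [card_tensorGraph_vertices] at key
  have h3 := mul_le_mul ((le_abs_self _).trans hfs) hM hM0 (by positivity)
  have h4 : (s : ℝ) / 32 * (16 / s * largestEigenvalue (tensorGraph s (s ^ 8))) =
      largestEigenvalue (tensorGraph s (s ^ 8)) / 2 := by
    field_simp; norm_num
  linarith

open Filter in
theorem exists_mul_maxBiAverageDegree_lt (K : ℝ) :
    ∃ (V : Type) (_ : Fintype V) (_ : Nonempty V) (G : SimpleGraph V),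
      K * maxBiAverageDegree G < largestEigenvalue G := by
  have h := maxBiAverageDegree_tensorGraph_isLittleO
  rw [Asymptotics.isLittleO_iff] at h
  -- The extra 1 in `|K| + 1` gives strictness when `M ≠ 0`; for `M = 0` positivity of the
  -- eigenvalue suffices.
  obtain ⟨s, hb, hs⟩ := ((h (c := 1 / (|K| + 1)) (by positivity)).and
    (eventually_ge_atTop 2)).exists
  have : Nonempty (Fin s) := ⟨⟨0, by omega⟩⟩
  have hpos := largestEigenvalue_tensorGraph_pos (t := s ^ 8) hs (pow_ne_zero _ (by omega))
  refine ⟨_, inferInstance, inferInstance, tensorGraph s (s ^ 8), ?_⟩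
  rw [Real.norm_of_nonneg hpos.le, Real.norm_eq_abs, one_div, ← div_eq_inv_mul,
    le_div_iff₀ (by positivity)] at hb
  set M := maxBiAverageDegree (tensorGraph s (s ^ 8))
  have h1 : K * M ≤ |M| * |K| := by
    rw [mul_comm, ← abs_mul]; exact le_abs_self _
  rcases (abs_nonneg M).eq_or_lt with h0 | h0
  · rw [← h0] at h1; linarith
  · linarith

end

theorem mainTheorem8 :
    -- the construction: `n = (2s)^t` with `t = s^8`, and an absolute constant `C`
    (∃ C : ℝ, 0 < C ∧ ∀ s t n : ℕ, 2 ≤ s → t = s ^ 8 → n = (2 * s) ^ t →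
      realAdjMatrix (tensorGraph s t) = kroneckerPower (blockMatrix s) t ∧
      Fintype.card (Fin t → Fin s ⊕ Fin s) = n ∧
      maxBiAverageDegree (tensorGraph s t) ≤
        C * (Real.log (Real.log n) / Real.log n) ^ (1 / 8 : ℝ) *
          largestEigenvalue (tensorGraph s t)) ∧
    -- these orders `n` are arbitrarily large
    (∀ N : ℕ, ∃ s : ℕ, 2 ≤ s ∧ N ≤ (2 * s) ^ (s ^ 8)) ∧
    -- along the construction, the maximum bi-average degree is `o` of the largest eigenvalue
    (fun s : ℕ => maxBiAverageDegree (tensorGraph s (s ^ 8)))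
      =o[Filter.atTop] (fun s : ℕ => largestEigenvalue (tensorGraph s (s ^ 8))) ∧
    -- no factor growing slower than `(log n / log log n)^(1/8)` is admissible
    (∀ f : ℕ → ℝ,
      (∀ (V : Type) [Fintype V] [Nonempty V] (G : SimpleGraph V),
        largestEigenvalue G ≤ f (Fintype.card V) * maxBiAverageDegree G) →
      ¬ f =o[Filter.atTop]
        (fun n : ℕ => (Real.log n / Real.log (Real.log n)) ^ (1 / 8 : ℝ))) ∧
    -- in particular, no constant factor is admissible
    (∀ K : ℝ, ∃ (V : Type) (_ : Fintype V) (_ : Nonempty V) (G : SimpleGraph V),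
      K * maxBiAverageDegree G < largestEigenvalue G) := by
  refine ⟨⟨16, by norm_num, ?_⟩, fun N => ?_, maxBiAverageDegree_tensorGraph_isLittleO,
    fun f hf => not_isLittleO_of_largestEigenvalue_le hf, exists_mul_maxBiAverageDegree_lt⟩
  · rintro s _ _ hs rfl rfl
    have ht : s ^ 8 ≠ 0 := pow_ne_zero _ (by omega)
    refine ⟨realAdjMatrix_tensorGraph s ht, card_tensorGraph_vertices _ _,
      (maxBiAverageDegree_tensorGraph_le hs).trans (mul_le_mul_of_nonneg_right ?_
        (largestEigenvalue_tensorGraph_pos hs ht).le)⟩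
    rw [← mul_one_div]
    exact mul_le_mul_of_nonneg_left (one_div_le_rpow_log hs) (by norm_num)
  · exact ⟨max 2 N, le_max_left _ _,
      (le_max_right _ _).trans (le_two_mul_pow_pow (le_max_left _ _))⟩
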